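/- Let $H$ be a separable infinite-dimensional complex Hilbert space with scalar product $(\cdot,\cdot)$. A linear operator $A$ in $H$ with domain $\operatorname{dom}A$ is called $m$-sectorial if - there is $\alpha\in[0,\pi/2)$ such that $|\arg (Au,u)|\le\alpha$ for all $u\in\operatorname{dom}A$ with $\|u\|=1$ (where $\arg 0:=0$), and - $A$ is $m$-accretive, i.e. $\operatorname{Re}(Au,u)\ge 0$ for all $u\in\operatorname{dom}A$, $\operatorname{dom}A$ is dense in $H$, and $\operatorname{ran}(A-\lambda I)=H$ for some $\lambda\in\mathbb C$ with $\operatorname{Re}\lambda<0$. The operator $A$ has compact resolvent if $(A-\lambda I)^{-1}$ exists as an everywhere defined compact operator on $H$ for some $\lambda\in\mathbb C$. **Theorem.** For every integer $n\ge 1$ there exists an $m$-sectorial operator $A$ in $H$ with $\dim(\operatorname{dom}A\cap\operatorname{dom}A^*)=n$. Moreover, $A$ may be chosen such that $\ker A=\{0\}$ and, in addition, with or without compact resolvent; that is, there is such an $A$ with $\ker A=\{0\}$ and compact resolvent, and there is such an $A$ with $\ker A=\{0\}$ whose resolvent is not compact. -/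

import Mathlib

/-- The numerical range `W(A) = {(Au, u) : u ∈ dom A, ‖u‖ = 1}` of a linear operator `A` in `H`
with domain `A.domain`. Mathlib's inner product is linear in its second argument, so `(Au, u)`
is written `inner ℂ u (A u)`. -/
def numRange {H : Type*} [NormedAddCommGroup H] [InnerProductSpace ℂ H]
    (A : H →ₗ.[ℂ] H) : Set ℂ :=
  {z | ∃ u : A.domain, ‖(u : H)‖ = 1 ∧ inner ℂ (u : H) (A u) = z}

/-- `A` is accretive: its numerical range lies in the closed right half-plane. -/
def IsAccretive {H : Type*} [NormedAddCommGroup H] [InnerProductSpace ℂ H]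
    (A : H →ₗ.[ℂ] H) : Prop :=
  numRange A ⊆ {z : ℂ | 0 ≤ z.re}

/-- `A` is `m`-accretive: it is accretive, densely defined, and `ran (A - z I) = H` for some
`z` with `Re z < 0`. -/
def IsMAccretive {H : Type*} [NormedAddCommGroup H] [InnerProductSpace ℂ H]
    (A : H →ₗ.[ℂ] H) : Prop :=
  IsAccretive A ∧ Dense (A.domain : Set H) ∧
    ∃ z : ℂ, z.re < 0 ∧ ∀ f : H, ∃ u : A.domain, A u - z • (u : H) = f

/-- `A` is sectorial with vertex `0` and semi-angle `α`: its numerical range lies in the closed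
sector `{z : |arg z| ≤ α}` (which contains `0`, as `Complex.arg 0 = 0`). -/
def IsSectorialWith {H : Type*} [NormedAddCommGroup H] [InnerProductSpace ℂ H]
    (A : H →ₗ.[ℂ] H) (α : ℝ) : Prop :=
  0 ≤ α ∧ α < Real.pi / 2 ∧ numRange A ⊆ {z : ℂ | |z.arg| ≤ α}

/-- `A` is `m`-sectorial: sectorial with some semi-angle `α ∈ [0, π/2)`, and `m`-accretive. -/
def IsMSectorial {H : Type*} [NormedAddCommGroup H] [InnerProductSpace ℂ H]
    (A : H →ₗ.[ℂ] H) : Prop :=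
  (∃ α : ℝ, IsSectorialWith A α) ∧ IsMAccretive A

/-- The bounded operator `R` on `H` is the resolvent `(A - z I)⁻¹` of `A` at `z`, that is,
a two-sided inverse of `A - z I : dom A → H`; such an `R` exists iff `z` is in the
resolvent set of `A`. -/
def IsResolventAt {H : Type*} [NormedAddCommGroup H] [InnerProductSpace ℂ H]
    (A : H →ₗ.[ℂ] H) (z : ℂ) (R : H →L[ℂ] H) : Prop :=
  (∀ f : H, ∃ h : R f ∈ A.domain, A ⟨R f, h⟩ - z • R f = f) ∧
    ∀ u : A.domain, R (A u - z • (u : H)) = u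

/-- `A` has compact resolvent: `(A - z I)⁻¹` is a compact operator for some `z` in the resolvent
set of `A` (equivalently, by the resolvent identity, the resolvent set is non-empty and this holds
for all its points). -/
def HasCompactResolvent {H : Type*} [NormedAddCommGroup H] [InnerProductSpace ℂ H]
    (A : H →ₗ.[ℂ] H) : Prop :=
  ∃ (z : ℂ) (R : H →L[ℂ] H), IsResolventAt A z R ∧ IsCompactOperator R

/-!
The operator `A` is constructed through its bounded inverse. Let `C` and `K` be bounded self-adjoint
operators, `C` injective, and put `T = C (1 - iK) C`, `A = T⁻¹`. Since
`⟪T f, f⟫ = ‖C f‖² + i ⟪K C f, C f⟫` has imaginary part at most `‖K‖` times its real part, `A` is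
`m`-sectorial with semi-angle `arctan ‖K‖` (`isMSectorial_inversePMap_sandwich`), it has trivial
kernel, and its resolvent is compact iff `T` is (`hasCompactResolvent_inversePMap_iff`).

The domain of `A` is `ran T` and that of `A*` is `ran T* = ran C (1 + iK) C`. Their intersection is
the image of `{s ∈ ran C | K s ∈ ran C}` under the injective operator `C (1 + K²)`
(`domain_inf_adjoint_domain_sandwich`), so it remains to find `C` and `K` for which the latter space
has dimension `n`.

Fix a Hilbert basis `b` indexed by `ℕ`. Take `C` diagonal with entries `9⁻ᵐ` at the even indices
`2m`, and `K = W + W*` with `W = ∑ₘ 4⁻ᵐ ⟪b (κ m), ·⟫ b (2m)`, where `κ` takes every value `k ≥ n`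
infinitely often, no value below `n`, and `κ m ≤ m + n`. The coefficient of `K x` at `2m` is
`4⁻ᵐ ⟪b (κ m), x⟫ + O(9⁻ᵐ)`, whereas the coefficients of a vector in `ran C` there are `O(9⁻ᵐ)`.
Hence `K x ∈ ran C` forces `⟪b k, x⟫ = 0` for every `k ≥ n`: let `m → ∞` with `κ m = k`
(`inner_eq_zero_of_add_adjoint_mem_range`). Conversely `b i` qualifies for `i < n`, because `K` maps
it to a multiple of a basis vector. So the space is spanned by `b i`, `i < n`
(`commonRange_eq_span`).

The entries of `C` at the odd indices are free. If all entries tend to `0` summably, then `C`, and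
with it `T`, is compact; if the odd entries are at least `1`, then `T` is not compact
(`not_isCompactOperator_sandwich`).
-/

open scoped InnerProductSpace
open ContinuousLinearMap

/-! ### Inverses of bounded injective operators -/

section InverseOperator

variable {H : Type*} [NormedAddCommGroup H] [InnerProductSpace ℂ H]

/-- The inverse `T⁻¹ : ran T → H` of an injective bounded operator `T`, as a partially defined
operator. -/
noncomputable def inversePMap (T : H →L[ℂ] H) (hT : Function.Injective T) : H →ₗ.[ℂ] H where
  domain := LinearMap.range T.toLinearMap
  toFun := (LinearEquiv.ofInjective T.toLinearMap hT).symm.toLinearMap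

lemma inversePMap_apply {T : H →L[ℂ] H} (hT : Function.Injective T) {f : H}
    {u : (inversePMap T hT).domain} (h : T f = u) : inversePMap T hT u = f := by
  obtain ⟨_, hu⟩ := u
  subst h
  exact (LinearEquiv.ofInjective T.toLinearMap hT).symm_apply_apply f

lemma ker_inversePMap {T : H →L[ℂ] H} (hT : Function.Injective T) :
    LinearMap.ker (inversePMap T hT).toFun = ⊥ :=
  LinearMap.ker_eq_bot.2 (LinearEquiv.ofInjective T.toLinearMap hT).symm.injective

lemma isResolventAt_zero_inversePMap {T : H →L[ℂ] H} (hT : Function.Injective T) :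
    IsResolventAt (inversePMap T hT) 0 T := by
  refine ⟨fun f ↦ ⟨⟨f, rfl⟩, by
    rw [zero_smul, sub_zero]; exact inversePMap_apply hT rfl⟩, ?_⟩
  rintro ⟨_, f, rfl⟩
  rw [zero_smul, sub_zero, inversePMap_apply hT rfl]
  rfl

/-- By the resolvent identity, if one resolvent of `T⁻¹` is compact, then so is `T`, the resolvent
at `0`. -/
lemma hasCompactResolvent_inversePMap_iff {T : H →L[ℂ] H} (hT : Function.Injective T) :
    HasCompactResolvent (inversePMap T hT) ↔ IsCompactOperator T := by
  refine ⟨?_, fun h ↦ ⟨0, T, isResolventAt_zero_inversePMap hT, h⟩⟩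
  rintro ⟨z, R, ⟨-, hR⟩, hc⟩
  have key : (T : H → H) = R ∘ (ContinuousLinearMap.id ℂ H - z • T) := by
    funext f
    have := hR ⟨T f, f, rfl⟩
    rw [inversePMap_apply hT rfl] at this
    simpa using this.symm
  rw [key]
  exact hc.comp_clm _

variable [CompleteSpace H]

/-- The domain of `(T⁻¹)*` is the range of `T*`. -/
lemma mem_adjoint_domain_inversePMap {T : H →L[ℂ] H} (hT : Function.Injective T)
    (hd : DenseRange T) {y : H} :
    y ∈ (inversePMap T hT).adjoint.domain ↔ ∃ g, adjoint T g = y := by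
  have hd' : Dense ((inversePMap T hT).domain : Set H) := hd
  constructor
  · intro hy
    refine ⟨(inversePMap T hT).adjoint ⟨y, hy⟩, ext_inner_right ℂ fun f ↦ ?_⟩
    have := (LinearPMap.adjoint_isFormalAdjoint hd').symm ⟨T f, f, rfl⟩ ⟨y, hy⟩
    rw [inversePMap_apply hT rfl] at this
    rw [adjoint_inner_left, ← inner_conj_symm, ← this, inner_conj_symm]
  · rintro ⟨g, rfl⟩
    refine LinearPMap.mem_adjoint_domain_of_exists _ ⟨g, ?_⟩
    rintro ⟨_, f, rfl⟩
    rw [inversePMap_apply hT rfl]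
    exact (adjoint_inner_left T f g).symm

end InverseOperator

lemma abs_arg_le_arctan {z : ℂ} {κ : ℝ} (hκ : 0 ≤ κ) (hz : 0 ≤ z.re) (h : |z.im| ≤ κ * z.re) :
    |z.arg| ≤ Real.arctan κ := by
  rcases hz.eq_or_lt with h0 | hpos
  · have him : z.im = 0 := by simpa [← h0] using h
    have hz0 : z = 0 := Complex.ext h0.symm him
    simpa [hz0] using hκ
  · have harg : z.arg = Real.arctan (z.im / z.re) := by
      have := abs_lt.1 (Complex.abs_arg_lt_pi_div_two_iff.2 (Or.inl hpos))
      rw [← Complex.tan_arg, Real.arctan_tan this.1 this.2]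
    rw [harg, abs_le, ← Real.arctan_neg]
    constructor <;> apply Real.arctan_le_arctan_iff.2
    · rw [le_div_iff₀ hpos]; nlinarith [(abs_le.1 h).1]
    · rw [div_le_iff₀ hpos]; exact (abs_le.1 h).2

/-! ### The operators `C (1 - iK) C` -/

section SectorialFactorization

variable {H : Type*} [NormedAddCommGroup H] [InnerProductSpace ℂ H]

/-- The bounded operator `C (1 - iK) C`. -/
noncomputable def sandwich (C K : H →L[ℂ] H) : H →L[ℂ] H :=
  C * (1 - Complex.I • K) * C

lemma sandwich_apply (C K : H →L[ℂ] H) (f : H) :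
    sandwich C K f = C (C f - Complex.I • K (C f)) := rfl

/-- The vectors `s` in the range of `C` for which `K s` is in the range of `C` as well. -/
def commonRange (C K : H →L[ℂ] H) : Submodule ℂ H :=
  LinearMap.range C.toLinearMap ⊓ (LinearMap.range C.toLinearMap).comap K.toLinearMap

lemma mem_commonRange {C K : H →L[ℂ] H} {s : H} :
    s ∈ commonRange C K ↔ (∃ a, C a = s) ∧ ∃ b, C b = K s := Iff.rfl

variable [CompleteSpace H] {C K : H →L[ℂ] H}

lemma adjoint_sandwich (hC : IsSelfAdjoint C) (hK : IsSelfAdjoint K) :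
    adjoint (sandwich C K) = sandwich C (-K) := by
  rw [← star_eq_adjoint]
  simp [sandwich, hC.star_eq, hK.star_eq, mul_assoc]

lemma inner_sandwich (hC : IsSelfAdjoint C) (f : H) :
    ⟪sandwich C K f, f⟫_ℂ = ‖C f‖ ^ 2 + Complex.I * ⟪K (C f), C f⟫_ℂ := by
  have h : ⟪C (C f - Complex.I • K (C f)), f⟫_ℂ = ⟪C f - Complex.I • K (C f), C f⟫_ℂ :=
    hC.isSymmetric _ _
  rw [sandwich_apply, h, inner_sub_left, inner_smul_left, inner_self_eq_norm_sq_to_K]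
  simp

lemma im_inner_apply_self (hK : IsSelfAdjoint K) (x : H) : (⟪K x, x⟫_ℂ).im = 0 :=
  hK.isSymmetric.im_inner_apply_self x

lemma re_inner_sandwich (hC : IsSelfAdjoint C) (hK : IsSelfAdjoint K) (f : H) :
    (⟪sandwich C K f, f⟫_ℂ).re = ‖C f‖ ^ 2 := by
  rw [inner_sandwich hC]
  simp [im_inner_apply_self hK, ← Complex.ofReal_pow]

lemma abs_im_inner_sandwich_le (hC : IsSelfAdjoint C) (hK : IsSelfAdjoint K) (f : H) :
    |(⟪sandwich C K f, f⟫_ℂ).im| ≤ ‖K‖ * (⟪sandwich C K f, f⟫_ℂ).re := by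
  rw [re_inner_sandwich hC hK, inner_sandwich hC]
  have h : |(⟪K (C f), C f⟫_ℂ).re| ≤ ‖K‖ * ‖C f‖ ^ 2 :=
    calc |(⟪K (C f), C f⟫_ℂ).re| ≤ ‖⟪K (C f), C f⟫_ℂ‖ := Complex.abs_re_le_norm _
      _ ≤ ‖K (C f)‖ * ‖C f‖ := norm_inner_le_norm _ _
      _ ≤ ‖K‖ * ‖C f‖ * ‖C f‖ := by gcongr; exact K.le_opNorm _
      _ = ‖K‖ * ‖C f‖ ^ 2 := by ring
  simpa [← Complex.ofReal_pow] using h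

lemma sandwich_injective (hC : IsSelfAdjoint C) (hK : IsSelfAdjoint K)
    (hinj : Function.Injective C) : Function.Injective (sandwich C K) := by
  refine (injective_iff_map_eq_zero _).2 fun f hf ↦ ?_
  have h := re_inner_sandwich hC hK f
  rw [hf, inner_zero_left, Complex.zero_re, eq_comm, sq_eq_zero_iff, norm_eq_zero] at h
  exact (injective_iff_map_eq_zero C).1 hinj f h

/-- A vector `f` orthogonal to the range satisfies `‖C f‖² = re ⟪C (1 - iK) C f, f⟫ = 0`. -/
lemma denseRange_sandwich (hC : IsSelfAdjoint C) (hK : IsSelfAdjoint K)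
    (hinj : Function.Injective C) : DenseRange (sandwich C K) := by
  have h : (LinearMap.range (sandwich C K).toLinearMap)ᗮ = ⊥ := by
    refine (Submodule.eq_bot_iff _).2 fun f hf ↦ ?_
    have h0 : ⟪sandwich C K f, f⟫_ℂ = 0 := hf _ ⟨f, rfl⟩
    have h := re_inner_sandwich hC hK f
    rw [h0, Complex.zero_re, eq_comm, sq_eq_zero_iff, norm_eq_zero] at h
    exact (injective_iff_map_eq_zero C).1 hinj f h
  exact (Submodule.dense_iff_topologicalClosure_eq_top).2
    ((Submodule.topologicalClosure_eq_top_iff).2 h)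

lemma isMSectorial_inversePMap_sandwich (hC : IsSelfAdjoint C) (hK : IsSelfAdjoint K)
    (hinj : Function.Injective C) :
    IsMSectorial (inversePMap (sandwich C K) (sandwich_injective hC hK hinj)) := by
  set T := sandwich C K with hTdef
  have hT : Function.Injective T := sandwich_injective hC hK hinj
  have hre : ∀ f, 0 ≤ (⟪T f, f⟫_ℂ).re := fun f ↦ by
    rw [re_inner_sandwich hC hK]; positivity
  refine ⟨⟨Real.arctan ‖K‖, Real.arctan_nonneg.2 (norm_nonneg _), Real.arctan_lt_pi_div_two _, ?_⟩,
    ?_, denseRange_sandwich hC hK hinj, ?_⟩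
  · rintro _ ⟨⟨_, f, rfl⟩, -, rfl⟩
    rw [inversePMap_apply hT rfl]
    exact abs_arg_le_arctan (norm_nonneg _) (hre f) (abs_im_inner_sandwich_le hC hK f)
  · rintro _ ⟨⟨_, f, rfl⟩, -, rfl⟩
    rw [inversePMap_apply hT rfl]
    exact hre f
  · -- For small `ε > 0` the operator `1 + ε T` is invertible by the Neumann series, and
    -- `(T⁻¹ + ε) T g = (1 + ε T) g`.
    obtain ⟨ε, hε, hεT⟩ : ∃ ε : ℝ, 0 < ε ∧ ε * ‖T‖ < 1 := by
      refine ⟨(‖T‖ + 1)⁻¹, by positivity, ?_⟩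
      rw [inv_mul_lt_iff₀ (by positivity)]
      linarith
    have hu : IsUnit (1 - (-(ε : ℂ)) • T) := by
      refine isUnit_one_sub_of_norm_lt_one ?_
      rw [norm_smul, norm_neg, Complex.norm_real, Real.norm_of_nonneg hε.le]
      exact hεT
    refine ⟨-(ε : ℂ), by simpa using hε, fun f ↦ ?_⟩
    obtain ⟨R, hR⟩ := hu.exists_right_inv
    refine ⟨⟨T (R f), R f, rfl⟩, ?_⟩
    rw [inversePMap_apply hT rfl]
    exact congr($hR f)

/-- The intersection of the ranges of `C (1 - iK) C` and `C (1 + iK) C` is the image of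
`commonRange C K` under `C (1 + K²)`: if `C (1 - iK) C f = C (1 + iK) C g` then
`s = C (f + g)` satisfies `i K s = C (f - g)`. -/
lemma domain_inf_adjoint_domain_sandwich (hC : IsSelfAdjoint C) (hK : IsSelfAdjoint K)
    (hinj : Function.Injective C) :
    (inversePMap (sandwich C K) (sandwich_injective hC hK hinj)).domain ⊓
      (inversePMap (sandwich C K) (sandwich_injective hC hK hinj)).adjoint.domain =
    (commonRange C K).map (C * (1 + K * K)).toLinearMap := by
  have hI : ∀ x : H, Complex.I • Complex.I • x = -x := fun x ↦ by
    rw [smul_smul, Complex.I_mul_I, neg_one_smul]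
  ext u
  rw [Submodule.mem_inf, mem_adjoint_domain_inversePMap _ (denseRange_sandwich hC hK hinj),
    adjoint_sandwich hC hK, Submodule.mem_map]
  constructor
  · rintro ⟨⟨f, hf : sandwich C K f = u⟩, g, hg⟩
    -- `u = T f = T* g`; cancel the outer factor `C`.
    have h1 : C f - Complex.I • K (C f) = C g + Complex.I • K (C g) := by
      apply hinj
      rw [← sandwich_apply, hf, ← hg, sandwich_apply]
      simp
    have h2 : Complex.I • K (C f + C g) = C f - C g := by
      rw [map_add, smul_add]
      generalize Complex.I • K (C f) = p, Complex.I • K (C g) = q at h1 ⊢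
      rw [sub_eq_iff_eq_add.1 h1]
      abel
    have h3 : K (C f + C g) = -Complex.I • (C f - C g) := by
      rw [← h2, neg_smul, hI, neg_neg]
    refine ⟨(2⁻¹ : ℂ) • (C f + C g), Submodule.smul_mem _ _ (mem_commonRange.2
      ⟨⟨f + g, map_add _ _ _⟩, -Complex.I • (f - g), by simp [h3]⟩), ?_⟩
    have h4 : C f = (2⁻¹ : ℂ) • ((C f + C g) + Complex.I • K (C f + C g)) := by
      rw [h2]; module
    generalize C f + C g = s at h4
    have h5 : C f - Complex.I • K (C f) = (2⁻¹ : ℂ) • s + K (K ((2⁻¹ : ℂ) • s)) := by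
      rw [h4]
      simp only [map_add, map_smul, smul_add, smul_comm Complex.I (2⁻¹ : ℂ), hI]
      module
    rw [← hf, sandwich_apply, h5]
    rfl
  · -- If `s = C a` and `K s = C b`, then `(1 + K²) s = (1 ∓ iK) C (a ± i b)`.
    rintro ⟨s, hs, rfl⟩
    obtain ⟨⟨a, ha⟩, b, hb⟩ := mem_commonRange.1 hs
    refine ⟨⟨a + Complex.I • b, ?_⟩, a - Complex.I • b, ?_⟩
    · change sandwich C K _ = _
      simp [sandwich_apply, ha, hb, hI]
      abel
    · simp [sandwich_apply, ha, hb, smul_sub, hI]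

lemma rank_domain_inf_adjoint_domain_sandwich (hC : IsSelfAdjoint C) (hK : IsSelfAdjoint K)
    (hinj : Function.Injective C) :
    Module.rank ℂ ↥((inversePMap (sandwich C K) (sandwich_injective hC hK hinj)).domain ⊓
      (inversePMap (sandwich C K) (sandwich_injective hC hK hinj)).adjoint.domain) =
    Module.rank ℂ (commonRange C K) := by
  rw [domain_inf_adjoint_domain_sandwich hC hK hinj]
  have h : Function.Injective (C * (1 + K * K)).toLinearMap := by
    refine (injective_iff_map_eq_zero _).2 fun x hx ↦ ?_
    have h0 : x + K (K x) = 0 := (injective_iff_map_eq_zero C).1 hinj _ hx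
    have h1 : ⟪x + K (K x), x⟫_ℂ = 0 := by rw [h0, inner_zero_left]
    rw [inner_add_left, show ⟪K (K x), x⟫_ℂ = ⟪K x, K x⟫_ℂ from hK.isSymmetric _ _,
      inner_self_eq_norm_sq_to_K, inner_self_eq_norm_sq_to_K] at h1
    have h2 : ‖x‖ ^ 2 + ‖K x‖ ^ 2 = 0 := by
      rw [← Complex.ofReal_inj]
      simpa using h1
    have : ‖x‖ = 0 := by nlinarith [sq_nonneg ‖x‖, sq_nonneg ‖K x‖]
    exact norm_eq_zero.1 this
  exact (Submodule.equivMapOfInjective _ h _).rank_eq.symm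

end SectorialFactorization

/-! ### Hilbert bases and diagonal operators -/

section HilbertBasisNat

variable {H : Type*} [NormedAddCommGroup H] [InnerProductSpace ℂ H]

lemma Orthonormal.countable_of_separableSpace [TopologicalSpace.SeparableSpace H] {ι : Type*}
    {v : ι → H} (hv : Orthonormal ℂ v) : Countable ι := by
  -- Orthonormal vectors have mutual distance `√2`, so the balls of radius `1/2` are disjoint.
  refine Pairwise.countable_of_isOpen_disjoint (s := fun i ↦ Metric.ball (v i) (1 / 2)) ?_
    (fun _ ↦ Metric.isOpen_ball) fun i ↦ ⟨v i, Metric.mem_ball_self (by norm_num)⟩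
  intro i j hij
  refine Metric.ball_disjoint_ball ?_
  have h : ‖v i - v j‖ ^ 2 = 2 := by
    rw [@norm_sub_sq ℂ, hv.1, hv.1, hv.2 hij]
    norm_num
  rw [dist_eq_norm]
  nlinarith [norm_nonneg (v i - v j)]

lemma nonempty_hilbertBasis_nat [CompleteSpace H] [TopologicalSpace.SeparableSpace H]
    (hH : ¬ FiniteDimensional ℂ H) : Nonempty (HilbertBasis ℕ ℂ H) := by
  obtain ⟨w, b, -⟩ := exists_hilbertBasis ℂ H
  have : Countable w := b.orthonormal.countable_of_separableSpace
  have : Infinite w := by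
    by_contra hfin
    rw [not_infinite_iff_finite] at hfin
    have := Fintype.ofFinite w
    exact hH (b.toOrthonormalBasis.toBasis.finiteDimensional_of_finite)
  obtain ⟨e⟩ := nonempty_equiv_of_countable (α := ℕ) (β := w)
  refine ⟨HilbertBasis.mk (b.orthonormal.comp e e.injective) ?_⟩
  rw [e.surjective.range_comp]
  exact b.dense_span.ge

end HilbertBasisNat

section DiagonalOperator

variable {H : Type*} [NormedAddCommGroup H] [InnerProductSpace ℂ H]
  (b : HilbertBasis ℕ ℂ H)

lemma HilbertBasis.ext_inner {x y : H} (h : ∀ i, ⟪b i, x⟫_ℂ = ⟪b i, y⟫_ℂ) : x = y := by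
  apply b.repr.injective
  ext i
  simpa [b.repr_apply_apply] using h i

/-- `C` is the diagonal operator with real entries `c i` in the basis `b`. -/
def IsDiagonal (C : H →L[ℂ] H) (c : ℕ → ℝ) : Prop :=
  ∀ i, C (b i) = (c i : ℂ) • b i

variable {b} {C : H →L[ℂ] H} {c : ℕ → ℝ}

lemma IsDiagonal.inner_apply (h : IsDiagonal b C c) (i : ℕ) (x : H) :
    ⟪b i, C x⟫_ℂ = c i * ⟪b i, x⟫_ℂ := by
  have h1 := (b.hasSum_repr x).mapL (innerSL ℂ (b i) ∘L C)
  refine h1.unique ?_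
  convert hasSum_single i fun j hj ↦ ?_ using 1
  · simp [h i, b.repr_apply_apply, b.orthonormal.1, mul_comm]
  · simp [h j, b.orthonormal.2 hj.symm]

lemma IsDiagonal.isSelfAdjoint [CompleteSpace H] (h : IsDiagonal b C c) : IsSelfAdjoint C := by
  refine ContinuousLinearMap.ext fun x ↦ b.ext_inner fun i ↦ ?_
  rw [star_eq_adjoint, adjoint_inner_right, h i, inner_smul_left, Complex.conj_ofReal,
    h.inner_apply]

lemma IsDiagonal.injective (h : IsDiagonal b C c) (hc : ∀ i, c i ≠ 0) :
    Function.Injective C := by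
  refine (injective_iff_map_eq_zero _).2 fun x hx ↦ b.ext_inner fun i ↦ ?_
  have := h.inner_apply i x
  rw [hx, inner_zero_right, eq_comm] at this
  simpa [hc i] using this

lemma summable_smul_rankOne [CompleteSpace H] {a : ℕ → ℝ} (ha : Summable fun i ↦ ‖a i‖)
    (p q : ℕ → ℕ) :
    Summable fun i ↦ (a i : ℂ) • InnerProductSpace.rankOne ℂ (b (p i)) (b (q i)) := by
  refine Summable.of_norm (ha.congr fun i ↦ ?_)
  simp [norm_smul, b.orthonormal.1]

lemma isCompactOperator_rankOne (x y : H) :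
    IsCompactOperator (InnerProductSpace.rankOne ℂ x y) :=
  (isCompactOperator_of_locallyCompactSpace_rng (toSpanSingleton ℂ x)).comp_clm (innerSL ℂ y)

variable (b)

lemma exists_isDiagonal_isCompactOperator [CompleteSpace H] (hc : Summable fun i ↦ ‖c i‖) :
    ∃ C : H →L[ℂ] H, IsDiagonal b C c ∧ IsCompactOperator C := by
  have hs := summable_smul_rankOne (b := b) hc id id
  refine ⟨∑' i, (c i : ℂ) • InnerProductSpace.rankOne ℂ (b i) (b i), fun j ↦ ?_, ?_⟩
  · refine (hs.hasSum.mapL (ContinuousLinearMap.apply ℂ H (b j))).unique ?_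
    convert hasSum_single j fun i hi ↦ ?_ using 1
    · simp [b.orthonormal.1]
    · simp [b.orthonormal.2 hi]
  · refine isCompactOperator_of_tendsto hs.hasSum (Filter.Eventually.of_forall fun s ↦ ?_)
    exact (compactOperator (RingHom.id ℂ) H H).sum_mem
      fun i _ ↦ (isCompactOperator_rankOne (b i) (b i)).smul (c i : ℂ)

lemma exists_isDiagonal_indicator [CompleteSpace H] (p : ℕ → Prop) [DecidablePred p] :
    ∃ E : H →L[ℂ] H, IsDiagonal b E (fun i ↦ if p i then 1 else 0) := by
  set U := (Submodule.span ℂ (b '' {i | p i})).topologicalClosure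
  refine ⟨U.starProjection, fun i ↦ ?_⟩
  by_cases hi : p i
  · have : b i ∈ U := Submodule.le_topologicalClosure _ (Submodule.subset_span ⟨i, hi, rfl⟩)
    simp [hi, Submodule.starProjection_eq_self_iff.2 this]
  · have : b i ∈ Uᗮ := by
      rw [Submodule.orthogonal_closure, Submodule.mem_orthogonal]
      intro u hu
      induction hu using Submodule.span_induction with
      | mem x hx =>
        obtain ⟨j, hj, rfl⟩ := hx
        exact b.orthonormal.2 (fun h ↦ hi (h ▸ hj))
      | zero => simp
      | add x y _ _ hx hy => simp [inner_add_left, hx, hy]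
      | smul a x _ hx => simp [inner_smul_left, hx]
    simpa [hi, Submodule.starProjection_apply_eq_zero_iff] using this

end DiagonalOperator

/-! ### The coupling operator and the common range -/

section Coupling

variable {H : Type*} [NormedAddCommGroup H] [InnerProductSpace ℂ H]

/-- `W` couples the basis vectors `b k` with `k ≥ n` to the even-indexed basis vectors: it is
`∑ₘ 4⁻ᵐ ⟪b (κ m), ·⟫ b (2m)`, where `κ m = n + (first component of the pair coded by m)` takes each
value `k ≥ n` infinitely often and satisfies `κ m ≤ m + n`. The last field is the only consequence
of this inequality that is needed. -/
structure IsCoupling (b : HilbertBasis ℕ ℂ H) (n : ℕ) (W : H →L[ℂ] H) : Prop where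
  inner_even : ∀ m x, ⟪b (2 * m), W x⟫_ℂ = (1 / 4 : ℝ) ^ m * ⟪b (m.unpair.1 + n), x⟫_ℂ
  inner_odd : ∀ m x, ⟪b (2 * m + 1), W x⟫_ℂ = 0
  norm_apply_le : ∀ k, ‖W (b k)‖ ≤ 4 * 3 ^ n * (1 / 3) ^ k

lemma exists_isCoupling [CompleteSpace H] (b : HilbertBasis ℕ ℂ H) (n : ℕ) :
    ∃ W : H →L[ℂ] H, IsCoupling b n W := by
  have hs := (summable_smul_rankOne (b := b) (a := fun m ↦ (1 / 4 : ℝ) ^ m)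
    (summable_geometric_of_lt_one (by norm_num) (by norm_num)).norm
    (fun m ↦ 2 * m) fun m ↦ m.unpair.1 + n).hasSum
  refine ⟨∑' m : ℕ, (((1 / 4 : ℝ) ^ m : ℝ) : ℂ) •
    InnerProductSpace.rankOne ℂ (b (2 * m)) (b (m.unpair.1 + n)),
    fun m x ↦ ?_, fun m x ↦ ?_, fun k ↦ ?_⟩
  · refine (hs.mapL (innerSL ℂ (b (2 * m)) ∘L ContinuousLinearMap.apply ℂ H x)).unique ?_
    convert hasSum_single m fun i hi ↦ ?_ using 1
    · simp [b.orthonormal.1]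
    · have : ⟪b (2 * m), b (2 * i)⟫_ℂ = 0 := b.orthonormal.2 (by omega)
      simp [this]
  · refine (hs.mapL (innerSL ℂ (b (2 * m + 1)) ∘L ContinuousLinearMap.apply ℂ H x)).unique ?_
    convert hasSum_zero using 2 with i
    have : ⟪b (2 * m + 1), b (2 * i)⟫_ℂ = 0 := b.orthonormal.2 (by omega)
    simp [this]
  · have hg : HasSum (fun m : ℕ ↦ (3 / 4 : ℝ) ^ m * (3 ^ n * (1 / 3) ^ k))
        (4 * (3 ^ n * (1 / 3) ^ k)) := by
      have h := hasSum_geometric_of_lt_one (r := (3 / 4 : ℝ)) (by norm_num) (by norm_num)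
      rw [show (1 - 3 / 4 : ℝ)⁻¹ = 4 by norm_num] at h
      exact h.mul_right _
    rw [mul_assoc]
    refine (hs.mapL (ContinuousLinearMap.apply ℂ H (b k))).norm_le_of_bounded hg fun m ↦ ?_
    -- The `m`-th term of the series for `W (b k)` vanishes unless `κ m = k`; then `k ≤ m + n`, and
    -- `4⁻ᵐ = (3/4)ᵐ 3⁻ᵐ ≤ (3/4)ᵐ 3ⁿ⁻ᵏ`.
    by_cases hk : m.unpair.1 + n = k
    · have hkm : k ≤ m + n := by
        have := m.unpair_left_le
        omega
      have h3 : (1 : ℝ) ≤ 3 ^ (m + n) * (1 / 3) ^ k := by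
        rw [one_div, inv_pow, ← div_eq_mul_inv, one_le_div (by positivity)]
        exact pow_le_pow_right₀ (by norm_num) hkm
      have h4 : ((3 / 4 : ℝ)) ^ m * (3 ^ n * (1 / 3) ^ k)
          = (1 / 4) ^ m * (3 ^ (m + n) * (1 / 3) ^ k) := by
        rw [pow_add, div_eq_mul_one_div 3 4, mul_pow]; ring
      rw [h4]
      simpa [hk, b.orthonormal.1, norm_smul] using h3
    · have : ⟪b (m.unpair.1 + n), b k⟫_ℂ = 0 := b.orthonormal.2 hk
      simp only [ContinuousLinearMap.apply_apply, smul_apply,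
        InnerProductSpace.rankOne_apply, this, zero_smul, smul_zero, norm_zero]
      positivity

end Coupling

section Construction

variable {H : Type*} [NormedAddCommGroup H] [InnerProductSpace ℂ H]
  {b : HilbertBasis ℕ ℂ H} {C W : H →L[ℂ] H} {c : ℕ → ℝ} {n : ℕ}

lemma coupling_apply_eq_zero (hW : IsCoupling b n W) {i : ℕ} (hi : i < n) : W (b i) = 0 := by
  refine b.ext_inner fun j ↦ ?_
  rw [inner_zero_right]
  obtain ⟨m, rfl | rfl⟩ := j.even_or_odd'
  · rw [hW.inner_even, b.orthonormal.2 (by omega), mul_zero]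
  · exact hW.inner_odd m _

variable [CompleteSpace H]

lemma inner_add_adjoint (x : H) (k : ℕ) :
    ⟪b k, (W + adjoint W) x⟫_ℂ = ⟪b k, W x⟫_ℂ + ⟪W (b k), x⟫_ℂ := by
  rw [add_apply, inner_add_right, adjoint_inner_right]

/-- If `(W + W*) x = C d`, comparing coefficients at `2m` with `m` the code of the pair
`(k - n, l)`, so that `κ m = k`, gives `|⟪b k, x⟫| = O((4/9)ᵐ)`. As `m ≥ l` and `l` is arbitrary, `⟪b k, x⟫`
vanishes. -/
lemma inner_eq_zero_of_add_adjoint_mem_range (hC : IsDiagonal b C c)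
    (hc : ∀ m, c (2 * m) = (1 / 9) ^ m) (hW : IsCoupling b n W) {x d : H}
    (hd : C d = (W + adjoint W) x) {k : ℕ} (hk : n ≤ k) : ⟪b k, x⟫_ℂ = 0 := by
  have hb : ∀ l : ℕ, ‖⟪b k, x⟫_ℂ‖ ≤ (4 / 9) ^ l * (‖d‖ + 4 * 3 ^ n * ‖x‖) := by
    intro l
    set m := Nat.pair (k - n) l with hm
    have hmk : m.unpair.1 + n = k := by rw [hm, Nat.unpair_pair]; exact Nat.sub_add_cancel hk
    have h1 : ((1 / 4 : ℝ) ^ m : ℂ) * ⟪b k, x⟫_ℂ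
        = (1 / 9 : ℝ) ^ m * ⟪b (2 * m), d⟫_ℂ - ⟪W (b (2 * m)), x⟫_ℂ := by
      have h2 := hC.inner_apply (2 * m) d
      rw [hd, inner_add_adjoint, hW.inner_even, hmk, hc] at h2
      rw [eq_sub_iff_add_eq, h2]
      push_cast
      rfl
    have h2 : ‖⟪b (2 * m), d⟫_ℂ‖ ≤ ‖d‖ := by
      simpa [b.orthonormal.1] using norm_inner_le_norm (𝕜 := ℂ) (b (2 * m)) d
    have h3 : ‖⟪W (b (2 * m)), x⟫_ℂ‖ ≤ 4 * 3 ^ n * (1 / 9) ^ m * ‖x‖ := by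
      refine (norm_inner_le_norm _ _).trans ?_
      gcongr
      refine (hW.norm_apply_le _).trans_eq ?_
      -- `‖W (b (2m))‖ ≤ 4 · 3ⁿ · (1/3) ^ (2m)`, and `(1/3) ^ (2m) = 9⁻ᵐ`.
      rw [pow_mul]
      norm_num
    have h4 : (1 / 4 : ℝ) ^ m * ‖⟪b k, x⟫_ℂ‖ ≤ (1 / 9) ^ m * (‖d‖ + 4 * 3 ^ n * ‖x‖) :=
      calc (1 / 4 : ℝ) ^ m * ‖⟪b k, x⟫_ℂ‖ = ‖((1 / 4 : ℝ) ^ m : ℂ) * ⟪b k, x⟫_ℂ‖ := by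
            rw [norm_mul, norm_pow, Complex.norm_real]; norm_num
        _ ≤ ‖((1 / 9 : ℝ) ^ m : ℂ) * ⟪b (2 * m), d⟫_ℂ‖ + ‖⟪W (b (2 * m)), x⟫_ℂ‖ := by
            rw [h1]; exact norm_sub_le _ _
        _ ≤ (1 / 9) ^ m * ‖d‖ + 4 * 3 ^ n * (1 / 9) ^ m * ‖x‖ := by
            refine add_le_add ?_ h3
            rw [norm_mul, norm_pow, Complex.norm_real, Real.norm_of_nonneg (by norm_num)]
            gcongr
        _ = _ := by ring
    calc ‖⟪b k, x⟫_ℂ‖ = 4 ^ m * ((1 / 4 : ℝ) ^ m * ‖⟪b k, x⟫_ℂ‖) := by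
          rw [← mul_assoc, ← mul_pow]; norm_num
      _ ≤ 4 ^ m * ((1 / 9) ^ m * (‖d‖ + 4 * 3 ^ n * ‖x‖)) := by gcongr
      _ = (4 / 9) ^ m * (‖d‖ + 4 * 3 ^ n * ‖x‖) := by
          rw [← mul_assoc, ← mul_pow]; norm_num
      _ ≤ (4 / 9) ^ l * (‖d‖ + 4 * 3 ^ n * ‖x‖) := by
          have : (4 / 9 : ℝ) ^ m ≤ (4 / 9) ^ l :=
            pow_le_pow_of_le_one (by norm_num) (by norm_num) (Nat.right_le_pair _ _)
          gcongr
  have ht : Filter.Tendsto (fun l : ℕ ↦ (4 / 9 : ℝ) ^ l * (‖d‖ + 4 * 3 ^ n * ‖x‖))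
      Filter.atTop (nhds 0) := by
    simpa using (tendsto_pow_atTop_nhds_zero_of_lt_one (r := (4 / 9 : ℝ)) (by norm_num)
      (by norm_num)).mul_const (‖d‖ + 4 * 3 ^ n * ‖x‖)
  exact norm_le_zero_iff.1 (ge_of_tendsto' ht hb)

lemma exists_adjoint_coupling_apply_eq_smul (hW : IsCoupling b n W) (i : ℕ) :
    ∃ (a : ℂ) (j : ℕ), adjoint W (b i) = a • b j := by
  obtain ⟨m, rfl | rfl⟩ := i.even_or_odd'
  · refine ⟨((1 / 4 : ℝ) ^ m : ℝ), m.unpair.1 + n, ext_inner_right ℂ fun x ↦ ?_⟩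
    rw [adjoint_inner_left, hW.inner_even, inner_smul_left, Complex.conj_ofReal,
      Complex.ofReal_pow]
  · refine ⟨0, 0, ext_inner_right ℂ fun x ↦ ?_⟩
    rw [adjoint_inner_left, hW.inner_odd, zero_smul, inner_zero_left]

lemma commonRange_eq_span (hC : IsDiagonal b C c) (hc0 : ∀ i, c i ≠ 0)
    (hc : ∀ m, c (2 * m) = (1 / 9) ^ m) (hW : IsCoupling b n W) :
    commonRange C (W + adjoint W) = Submodule.span ℂ (Set.range fun i : Fin n ↦ b i) := by
  apply le_antisymm
  · intro x hx
    obtain ⟨-, d, hd⟩ := mem_commonRange.1 hx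
    have hx' : x = ∑ i : Fin n, ⟪b i, x⟫_ℂ • b i := by
      refine b.ext_inner fun k ↦ ?_
      rw [inner_sum]
      simp only [inner_smul_right]
      by_cases hk : k < n
      · rw [Finset.sum_eq_single ⟨k, hk⟩]
        · simp [b.orthonormal.1]
        · intro j _ hj
          rw [b.orthonormal.2 (fun h ↦ hj (Fin.ext h.symm)), mul_zero]
        · simp
      · rw [inner_eq_zero_of_add_adjoint_mem_range hC hc hW hd (not_lt.1 hk),
          Finset.sum_eq_zero]
        intro j _
        rw [b.orthonormal.2 (by omega), mul_zero]
    rw [hx']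
    exact Submodule.sum_mem _ fun i _ ↦
      Submodule.smul_mem _ _ (Submodule.subset_span ⟨i, rfl⟩)
  · have hr : ∀ (a : ℂ) j, ∃ f, C f = a • b j := fun a j ↦
      ⟨(a * (c j : ℂ)⁻¹) • b j, by
        rw [map_smul, hC j, smul_smul, mul_assoc, inv_mul_cancel₀ (by exact_mod_cast hc0 j),
          mul_one]⟩
    rw [Submodule.span_le]
    rintro _ ⟨i, rfl⟩
    refine mem_commonRange.2 ⟨by simpa using hr 1 i, ?_⟩
    obtain ⟨a, j, h⟩ := exists_adjoint_coupling_apply_eq_smul hW i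
    rw [add_apply, coupling_apply_eq_zero hW i.2, zero_add, h]
    exact hr a j

lemma rank_commonRange (hC : IsDiagonal b C c) (hc0 : ∀ i, c i ≠ 0)
    (hc : ∀ m, c (2 * m) = (1 / 9) ^ m) (hW : IsCoupling b n W) :
    Module.rank ℂ (commonRange C (W + adjoint W)) = n := by
  have hinj : Function.Injective fun i : Fin n ↦ b i :=
    b.orthonormal.linearIndependent.injective.comp Fin.val_injective
  have hli : LinearIndependent ℂ fun i : Fin n ↦ b i :=
    b.orthonormal.linearIndependent.comp _ Fin.val_injective
  rw [commonRange_eq_span hC hc0 hc hW, rank_span hli,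
    ← Cardinal.lift_inj, Cardinal.mk_range_eq_of_injective hinj]
  simp

/-- On the odd basis vectors the real part `C²` of `C (1 - iK) C` is bounded below, so their images
stay a fixed distance apart. -/
lemma not_isCompactOperator_sandwich {K : H →L[ℂ] H} (hC : IsDiagonal b C c)
    (hK : IsSelfAdjoint K) (hc : ∀ i, 1 ≤ c (2 * i + 1)) :
    ¬ IsCompactOperator (sandwich C K) := by
  intro hcomp
  have hsep : ∀ i j, i ≠ j →
      1 ≤ dist (sandwich C K (b (2 * i + 1))) (sandwich C K (b (2 * j + 1))) := by
    intro i j hij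
    have hbij : ⟪b (2 * i + 1), b (2 * j + 1)⟫_ℂ = 0 := b.orthonormal.2 (by omega)
    set g := b (2 * i + 1) - b (2 * j + 1) with hg
    have hgn : ‖g‖ ^ 2 = 2 := by
      rw [hg, @norm_sub_sq ℂ, b.orthonormal.1, b.orthonormal.1, hbij]
      norm_num
    have hCg : 2 ≤ ‖C g‖ ^ 2 := by
      rw [hg, map_sub, hC, hC, @norm_sub_sq ℂ, inner_smul_left, inner_smul_right, hbij,
        norm_smul, norm_smul, b.orthonormal.1, b.orthonormal.1, Complex.norm_real,
        Complex.norm_real, Real.norm_of_nonneg (zero_le_one.trans (hc i)),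
        Real.norm_of_nonneg (zero_le_one.trans (hc j))]
      simp only [mul_zero, map_zero, sub_zero, mul_one]
      nlinarith [hc i, hc j]
    have h1 : 2 ≤ ‖sandwich C K g‖ * ‖g‖ :=
      calc 2 ≤ ‖C g‖ ^ 2 := hCg
        _ = (⟪sandwich C K g, g⟫_ℂ).re := (re_inner_sandwich hC.isSelfAdjoint hK g).symm
        _ ≤ ‖⟪sandwich C K g, g⟫_ℂ‖ := Complex.re_le_norm _
        _ ≤ _ := norm_inner_le_norm _ _
    rw [dist_eq_norm, ← map_sub, ← hg]
    nlinarith [norm_nonneg g, norm_nonneg (sandwich C K g)]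
  obtain ⟨S, hS, hsub⟩ := hcomp.image_closedBall_subset_compact 1
  have hmem : ∀ i, sandwich C K (b (2 * i + 1)) ∈ S := fun i ↦
    hsub ⟨_, by simp [b.orthonormal.1], rfl⟩
  obtain ⟨a, -, φ, hφ, hlim⟩ := hS.tendsto_subseq hmem
  obtain ⟨N, hN⟩ := Metric.cauchySeq_iff.1 hlim.cauchySeq 1 one_pos
  exact (hN N le_rfl (N + 1) N.le_succ).not_ge (hsep _ _ (hφ.injective.ne N.succ_ne_self.symm))

end Construction

theorem theorem3p3 {H : Type*} [NormedAddCommGroup H] [InnerProductSpace ℂ H] [CompleteSpace H]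
    [TopologicalSpace.SeparableSpace H] (hH : ¬ FiniteDimensional ℂ H) (n : ℕ) (hn : 0 < n) :
    (∃ A : H →ₗ.[ℂ] H, IsMSectorial A ∧
      Module.rank ℂ ↥(A.domain ⊓ A.adjoint.domain) = n ∧
      LinearMap.ker A.toFun = ⊥ ∧ HasCompactResolvent A) ∧
    (∃ A : H →ₗ.[ℂ] H, IsMSectorial A ∧
      Module.rank ℂ ↥(A.domain ⊓ A.adjoint.domain) = n ∧
      LinearMap.ker A.toFun = ⊥ ∧ ¬ HasCompactResolvent A) := by
  obtain ⟨b⟩ := nonempty_hilbertBasis_nat hH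
  obtain ⟨W, hW⟩ := exists_isCoupling b n
  have hK : IsSelfAdjoint (W + adjoint W) := IsSelfAdjoint.add_star_self W
  have hpow : ∀ m : ℕ, (1 / 3 : ℝ) ^ (2 * m) = (1 / 9) ^ m := fun m ↦ by
    rw [pow_mul]; norm_num
  -- The entries `3⁻ⁱ` are summable and equal `9⁻ᵐ` at `i = 2m`.
  obtain ⟨C, hC, hCc⟩ := exists_isDiagonal_isCompactOperator b (c := fun i ↦ (1 / 3 : ℝ) ^ i)
    (summable_geometric_of_lt_one (by norm_num) (by norm_num)).norm
  refine ⟨?_, ?_⟩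
  · have hc0 : ∀ i : ℕ, (1 / 3 : ℝ) ^ i ≠ 0 := fun i ↦ by positivity
    refine ⟨_, isMSectorial_inversePMap_sandwich hC.isSelfAdjoint hK (hC.injective hc0), ?_,
      ker_inversePMap _, (hasCompactResolvent_inversePMap_iff _).2 ?_⟩
    · rw [rank_domain_inf_adjoint_domain_sandwich hC.isSelfAdjoint hK (hC.injective hc0),
        rank_commonRange hC hc0 hpow hW]
    · exact hCc.comp_clm ((1 - Complex.I • (W + adjoint W)) * C)
  · -- Raising the odd entries of `C` by `1` destroys compactness and leaves the even ones alone.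
    obtain ⟨E, hE⟩ := exists_isDiagonal_indicator b Odd
    have hCE : IsDiagonal b (C + E) (fun i ↦ (1 / 3 : ℝ) ^ i + if Odd i then 1 else 0) := by
      intro i
      rw [add_apply, hC i, hE i, ← add_smul, Complex.ofReal_add]
    have hc0 : ∀ i : ℕ, ((1 / 3 : ℝ) ^ i + if Odd i then 1 else 0) ≠ 0 := fun i ↦ by
      have : (0 : ℝ) ≤ if Odd i then 1 else 0 := by split_ifs <;> norm_num
      positivity
    refine ⟨_, isMSectorial_inversePMap_sandwich hCE.isSelfAdjoint hK (hCE.injective hc0), ?_,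
      ker_inversePMap _, fun h ↦ not_isCompactOperator_sandwich hCE hK ?_
        ((hasCompactResolvent_inversePMap_iff _).1 h)⟩
    · rw [rank_domain_inf_adjoint_domain_sandwich hCE.isSelfAdjoint hK (hCE.injective hc0),
        rank_commonRange hCE hc0 (fun m ↦ ?_) hW]
      rw [if_neg (by simp), add_zero, hpow]
    · intro i
      rw [if_pos (odd_two_mul_add_one i)]
      linarith [show (0 : ℝ) ≤ (1 / 3) ^ (2 * i + 1) by positivity]
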